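/- Let $n\ge 1$ and $x=(x_1,\dots,x_n)\in\mathbb R^n$. For $\lambda\ge 0$ consider the one-dimensional $\ell_1$ convex clustering problem $$(P_\lambda)\qquad \min_{B\in\mathbb R^n}\ \frac12\|B-x\|_2^2+\lambda\sum_{1\le i<i'\le n}|B_{i'}-B_i| .$$ The clustering associated to a vector $B\in\mathbb R^n$ with distinct values $b_1>\dots>b_K$ is $(\mathcal C_1,\dots,\mathcal C_K)$ with $\mathcal C_k=\{i: B_i=b_k\}$. Consider the following regularization path algorithm with input $x$. *Initialization.* $r=0$ and $\lambda^{(0)}=0$. Let $\mathcal C^{(0)}=(\mathcal C^{(0)}_1,\dots,\mathcal C^{(0)}_{K^{(0)}})$ be the clustering associated to $x$, let $n^{(0)}_k=|\mathcal C^{(0)}_k|$, and let $\hat b^{(0)}_1(\lambda^{(0)})>\dots>\hat b^{(0)}_{K^{(0)}}(\lambda^{(0)})$ be the distinct values of $x$. *While $K^{(r)}\ge 2$:* 1. For $\lambda\ge\lambda^{(r)}$ and $1\le k\le K^{(r)}$ set $$\hat b^{(r)}_k(\lambda)=\hat b^{(r)}_k(\lambda^{(r)})+(\lambda-\lambda^{(r)})\Big(\sum_{k'=1}^{k-1}n^{(r)}_{k'}-\sum_{k'=k+1}^{K^{(r)}}n^{(r)}_{k'}\Big),\qquad(\ast)$$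 and $\hat B^{(r)}_i(\lambda)=\hat b^{(r)}_k(\lambda)$ for $i\in\mathcal C^{(r)}_k$. 2. Set $$\lambda^{(r+1)}=\lambda^{(r)}+\min_{1\le k\le K^{(r)}-1}\frac{\hat b^{(r)}_k(\lambda^{(r)})-\hat b^{(r)}_{k+1}(\lambda^{(r)})}{n^{(r)}_k+n^{(r)}_{k+1}} .$$ 3. Let $(\hat b^{(r+1)}_k(\lambda^{(r+1)}))_{1\le k\le K^{(r+1)}}$ be the distinct values of $(\hat b^{(r)}_k(\lambda^{(r+1)}))_{1\le k\le K^{(r)}}$ sorted decreasingly, let $\mathcal C^{(r+1)}$ be the clustering associated to $\hat B^{(r)}(\lambda^{(r+1)})$, and let $n^{(r+1)}_k=|\mathcal C^{(r+1)}_k|$. Replace $r$ by $r+1$. **Theorem.** The algorithm stops, at a final value $r_{\max}$ of $r$ satisfying $r_{\max}\le n-1$, and $$K^{(0)}>K^{(1)}>\dots>K^{(r_{\max})}=1 .$$ Let $\lambda^{(r_{\max}+1)}=+\infty$ by convention, and define $\hat B^{(r_{\max})}(\lambda)$ for $\lambda\ge\lambda^{(r_{\max})}$ by $(\ast)$ as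 well (empty sums being $0$). Then for every $r\in\{0,\dots,r_{\max}\}$ and every $\lambda\in[\lambda^{(r)},\lambda^{(r+1)})$, the vector $(\hat B^{(r)}_i(\lambda))_{1\le i\le n}$ is the unique minimizer of $(P_\lambda)$. Moreover, for $\lambda\ge\lambda^{(r_{\max})}$ all the components of $\hat B^{(r_{\max})}(\lambda)$ are equal to $\frac1n\sum_{i=1}^n x_i$. -/

import Mathlib

open Finset

noncomputable section

namespace ConvexClustering

/-- The objective `½ ‖B - x‖₂² + lam ∑_{i < i'} |B i' - B i|` of one-dimensional `ℓ¹` convex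
clustering of the observations `x`. -/
def objective {n : ℕ} (x : Fin n → ℝ) (lam : ℝ) (B : Fin n → ℝ) : ℝ :=
  1 / 2 * ∑ i, (B i - x i) ^ 2 + lam * ∑ i, ∑ i' ∈ Finset.Ioi i, |B i' - B i|

/-- `B` is a minimizer over `ℝⁿ` of the convex clustering objective. -/
def IsMinimizer {n : ℕ} (x : Fin n → ℝ) (lam : ℝ) (B : Fin n → ℝ) : Prop :=
  IsMinOn (objective x lam) Set.univ B

/-- The elements of a set of `K` reals, sorted decreasingly. -/
def sortedDesc {K : ℕ} (s : Finset ℝ) (h : s.card = K) (k : Fin K) : ℝ :=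
  s.orderEmbOfFin h k.rev

theorem sortedDesc_mem {K : ℕ} (s : Finset ℝ) (h : s.card = K) (k : Fin K) :
    sortedDesc s h k ∈ s :=
  s.orderEmbOfFin_mem h _

theorem sortedDesc_strictAnti {K : ℕ} (s : Finset ℝ) (h : s.card = K) :
    StrictAnti (sortedDesc s h) := fun _ _ hab =>
  (s.orderEmbOfFin h).strictMono (Fin.rev_lt_rev.2 hab)

theorem exists_sortedDesc_eq {K : ℕ} (s : Finset ℝ) (h : s.card = K) {a : ℝ} (ha : a ∈ s) :
    ∃ k, sortedDesc s h k = a := by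
  have : a ∈ Set.range (s.orderEmbOfFin h) := by
    rw [Finset.range_orderEmbOfFin]; exact ha
  obtain ⟨k, hk⟩ := this
  exact ⟨k.rev, by simpa [sortedDesc] using hk⟩

/-- The finite set of distinct values of a vector. -/
def distinctValues {ι : Type} [Fintype ι] (v : ι → ℝ) : Finset ℝ :=
  Finset.univ.image v

/-- A clustering of the index set: an ordered partition into `K` nonempty clusters. -/
structure Clustering (n : ℕ) where
  K : ℕ
  cluster : Fin K → Finset (Fin n)
  nonempty : ∀ k, (cluster k).Nonempty
  existsUnique_mem : ∀ i, ∃! k, i ∈ cluster k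

/-- The unique `k` such that `i` belongs to the `k`-th cluster. -/
def Clustering.label {n : ℕ} (C : Clustering n) (i : Fin n) : Fin C.K :=
  (C.existsUnique_mem i).choose

theorem Clustering.mem_label {n : ℕ} (C : Clustering n) (i : Fin n) :
    i ∈ C.cluster (C.label i) :=
  (C.existsUnique_mem i).choose_spec.1

theorem Clustering.label_eq {n : ℕ} (C : Clustering n) {i : Fin n} {k : Fin C.K}
    (h : i ∈ C.cluster k) : C.label i = k :=
  (C.existsUnique_mem i).unique (C.mem_label i) h

theorem Clustering.label_surjective {n : ℕ} (C : Clustering n) :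
    Function.Surjective C.label := fun k =>
  let ⟨i, hi⟩ := C.nonempty k
  ⟨i, C.label_eq hi⟩

/-- The clustering associated to a vector `B`: with `b₁ > ⋯ > b_K` the distinct values of `B`,
the `k`-th cluster is `{i | B i = b_k}`. -/
def clusteringOf {n : ℕ} (B : Fin n → ℝ) : Clustering n where
  K := (distinctValues B).card
  cluster k := {i | B i = sortedDesc (distinctValues B) rfl k}
  nonempty k := by
    obtain ⟨i, -, hi⟩ := Finset.mem_image.1 (sortedDesc_mem (distinctValues B) rfl k)
    exact ⟨i, by simpa using hi⟩
  existsUnique_mem i := by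
    obtain ⟨k, hk⟩ := exists_sortedDesc_eq (distinctValues B) rfl
      (Finset.mem_image_of_mem B (Finset.mem_univ i))
    refine ⟨k, by simpa using hk.symm, fun l hl => ?_⟩
    have hl' : B i = sortedDesc (distinctValues B) rfl l := by simpa using hl
    exact (sortedDesc_strictAnti (distinctValues B) rfl).injective (hl'.symm.trans hk.symm)

/-- The variables of the regularization path algorithm at step `r`: the value `lam = λ⁽ʳ⁾`, the
clustering `𝒞⁽ʳ⁾` and the cluster values `b k = b̂⁽ʳ⁾ₖ(λ⁽ʳ⁾)`. -/
structure State (n : ℕ) where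
  lam : ℝ
  clusters : Clustering n
  b : Fin clusters.K → ℝ

namespace State

variable {n : ℕ} (S : State n)

/-- The number of clusters `K⁽ʳ⁾`. -/
def K : ℕ := S.clusters.K

/-- The size of the `k`-th cluster. -/
def size (k : Fin S.clusters.K) : ℕ := (S.clusters.cluster k).card

/-- `b̂⁽ʳ⁾ₖ(t) = b̂⁽ʳ⁾ₖ(λ⁽ʳ⁾) + (t - λ⁽ʳ⁾) (∑_{k' < k} n⁽ʳ⁾ₖ' - ∑_{k' > k} n⁽ʳ⁾ₖ')`. -/
def bhat (t : ℝ) (k : Fin S.clusters.K) : ℝ :=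
  S.b k + (t - S.lam) *
    (∑ k' ∈ Finset.Iio k, (S.size k' : ℝ) - ∑ k' ∈ Finset.Ioi k, (S.size k' : ℝ))

/-- `B̂⁽ʳ⁾ᵢ(t) = b̂⁽ʳ⁾ₖ(t)` for the unique `k` whose cluster contains `i`. -/
def Bhat (t : ℝ) (i : Fin n) : ℝ := S.bhat t (S.clusters.label i)

theorem distinctValues_bhat (t : ℝ) :
    (distinctValues (S.bhat t)).card = (distinctValues (S.Bhat t)).card := by
  congr 1
  ext a
  simp only [distinctValues, Finset.mem_image, Finset.mem_univ, true_and, Bhat]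
  exact S.clusters.label_surjective.exists

/-- `λ⁽ʳ⁺¹⁾ = λ⁽ʳ⁾ + min_{1 ≤ k ≤ K - 1} (b̂ₖ(λ⁽ʳ⁾) - b̂ₖ₊₁(λ⁽ʳ⁾)) / (nₖ + nₖ₊₁)`. -/
def nextLam (h : 2 ≤ S.K) : ℝ :=
  S.lam + (Finset.univ : Finset (Fin (S.clusters.K - 1))).inf'
    ⟨⟨0, Nat.sub_pos_of_lt h⟩, Finset.mem_univ _⟩ fun k =>
      (S.b ⟨k, by omega⟩ - S.b ⟨k + 1, by omega⟩) /
        ((S.size ⟨k, by omega⟩ : ℝ) + (S.size ⟨k + 1, by omega⟩ : ℝ))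

/-- The body of the `while` loop: the clustering becomes that of the vector `B̂⁽ʳ⁾(λ⁽ʳ⁺¹⁾)`, and
the cluster values become the distinct values of `b̂⁽ʳ⁾(λ⁽ʳ⁺¹⁾)`, sorted decreasingly. -/
def step (h : 2 ≤ S.K) : State n where
  lam := S.nextLam h
  clusters := clusteringOf (S.Bhat (S.nextLam h))
  b := sortedDesc (distinctValues (S.bhat (S.nextLam h))) (S.distinctValues_bhat _)

/-- The initial state for the observations `x`. -/
def init (x : Fin n → ℝ) : State n where
  lam := 0
  clusters := clusteringOf x
  b := sortedDesc (distinctValues x) rfl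

end State

/-- The state of the algorithm at step `r`, run on the observations `x`: the loop body is executed
as long as there are at least two clusters (and nothing changes once the loop has stopped). -/
def path {n : ℕ} (x : Fin n → ℝ) : ℕ → State n
  | 0 => State.init x
  | r + 1 => if h : 2 ≤ (path x r).K then (path x r).step h else path x r

/-- The algorithm stops at step `r`: this is the first step at which the loop condition `K ≥ 2`
fails. -/
def StopsAt {n : ℕ} (x : Fin n → ℝ) (r : ℕ) : Prop :=
  (∀ s < r, 2 ≤ (path x s).K) ∧ ¬ 2 ≤ (path x r).K

end ConvexClustering

end

namespace ConvexClustering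

variable {n : ℕ}

/-! Optimality is proved by duality. An antisymmetric matrix `w` of subgradients of the penalty,
with row sums `x - B`, shows that the objective at any `C` exceeds that at `B` by at least `½‖C -
B‖²`, so `B` is the unique minimizer (`IsCertificate.objective_add_le`).

Such a `w` is carried along the path, starting from `w = 0` at `λ = 0`. Entries between distinct
clusters are forced to be `±λ`; moving them to `±t` and freezing those inside clusters changes the
row sums exactly as the slopes in `bhat` require. This stays valid while the cluster values remain
ordered, that is, up to the first collision of neighbours at `nextLam`. A merge changes the labels
but not the vector, so the certificate survives it. Each step merges at least two clusters, so the
algorithm terminates. -/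

/-- A dual certificate for the optimality of `B`: an antisymmetric matrix `w` with
`w i j ∈ lam • ∂|·| (B i - B j)` that satisfies the stationarity equations. -/
structure IsCertificate (x : Fin n → ℝ) (lam : ℝ) (B : Fin n → ℝ) (w : Fin n → Fin n → ℝ) :
    Prop where
  antisymm : ∀ i j, w j i = -w i j
  abs_le : ∀ i j, |w i j| ≤ lam
  mul_sub : ∀ i j, w i j * (B i - B j) = lam * |B i - B j|
  stationary : ∀ i, x i - B i = ∑ j, w i j

/-- Summation by parts: swapping indices in the terms with `j < i` pairs them, by antisymmetry, with
those with `j > i`. -/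
theorem sum_sum_mul_eq_sum_Ioi {w : Fin n → Fin n → ℝ} (hw : ∀ i j, w j i = -w i j)
    (D : Fin n → ℝ) :
    ∑ i, (∑ j, w i j) * D i = ∑ i, ∑ j ∈ Ioi i, w i j * (D i - D j) := by
  have hdiag : ∀ i, w i i = 0 := fun i => by linarith [hw i i]
  have h : ∀ i, (∑ j, w i j) * D i = ∑ j ∈ Iio i, w i j * D i + ∑ j ∈ Ioi i, w i j * D i := by
    intro i
    rw [sum_mul, ← sum_subset (subset_univ (Iio i ∪ Ioi i))]
    · refine sum_union (disjoint_left.2 fun a ha hb => ?_)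
      exact lt_asymm (mem_Iio.1 ha) (mem_Ioi.1 hb)
    · intro j _ hj
      have : i = j := by
        by_contra hne
        rcases lt_or_gt_of_ne hne with h | h <;> simp [h] at hj
      simp [← this, hdiag]
  have hswap : ∑ i, ∑ j ∈ Iio i, w i j * D i = ∑ i, ∑ j ∈ Ioi i, w j i * D j :=
    sum_comm' (by simp)
  simp_rw [h, sum_add_distrib, hswap, ← sum_add_distrib]
  refine sum_congr rfl fun i _ => ?_
  refine sum_congr rfl fun j _ => ?_
  rw [hw i j]; ring

theorem IsCertificate.objective_add_le {x B : Fin n → ℝ} {lam : ℝ} {w : Fin n → Fin n → ℝ}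
    (h : IsCertificate x lam B w) (C : Fin n → ℝ) :
    objective x lam B + 1 / 2 * ∑ i, (C i - B i) ^ 2 ≤ objective x lam C := by
  have hpen : lam * ∑ i, ∑ i' ∈ Ioi i, |B i' - B i| + ∑ i, (x i - B i) * (C i - B i) ≤
      lam * ∑ i, ∑ i' ∈ Ioi i, |C i' - C i| := by
    simp_rw [h.stationary, sum_sum_mul_eq_sum_Ioi h.antisymm, mul_sum, ← sum_add_distrib]
    refine sum_le_sum fun i _ => sum_le_sum fun j _ => ?_
    have h1 : w i j * (C i - C j) ≤ lam * |C j - C i| := by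
      rw [abs_sub_comm]
      calc w i j * (C i - C j) ≤ |w i j * (C i - C j)| := le_abs_self _
        _ = |w i j| * |C i - C j| := abs_mul _ _
        _ ≤ lam * |C i - C j| := by gcongr; exact h.abs_le i j
    have h2 := h.mul_sub i j
    rw [abs_sub_comm] at h2
    linarith
  have hquad : ∑ i, (C i - x i) ^ 2 =
      ∑ i, (B i - x i) ^ 2 + ∑ i, (C i - B i) ^ 2 - 2 * ∑ i, (x i - B i) * (C i - B i) := by
    rw [mul_sum, ← sum_add_distrib, ← sum_sub_distrib]
    exact sum_congr rfl fun i _ => by ring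
  unfold objective
  linarith

theorem IsCertificate.isMinimizer {x B : Fin n → ℝ} {lam : ℝ} {w : Fin n → Fin n → ℝ}
    (h : IsCertificate x lam B w) : IsMinimizer x lam B := fun C _ => by
  have := h.objective_add_le C
  have : 0 ≤ ∑ i, (C i - B i) ^ 2 := sum_nonneg fun i _ => sq_nonneg _
  show objective x lam B ≤ objective x lam C
  linarith

theorem IsCertificate.eq_of_isMinimizer {x B C : Fin n → ℝ} {lam : ℝ} {w : Fin n → Fin n → ℝ}
    (h : IsCertificate x lam B w) (hC : IsMinimizer x lam C) : C = B := by
  have h1 := h.objective_add_le C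
  have h2 : objective x lam C ≤ objective x lam B := hC (Set.mem_univ B)
  have h3 : ∑ i, (C i - B i) ^ 2 = 0 :=
    le_antisymm (by linarith) (sum_nonneg fun i _ => sq_nonneg _)
  funext i
  have := (sum_eq_zero_iff_of_nonneg fun i _ => sq_nonneg (C i - B i)).1 h3 i (mem_univ i)
  exact sub_eq_zero.1 (pow_eq_zero_iff two_ne_zero |>.1 this)

theorem IsCertificate.sum_eq {x B : Fin n → ℝ} {lam : ℝ} {w : Fin n → Fin n → ℝ}
    (h : IsCertificate x lam B w) : ∑ i, B i = ∑ i, x i := by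
  have := sum_sum_mul_eq_sum_Ioi h.antisymm 1
  simp only [Pi.one_apply, mul_one, sub_self, mul_zero, sum_const_zero, ← h.stationary,
    sum_sub_distrib] at this
  linarith

theorem Clustering.mem_cluster_iff (C : Clustering n) {i : Fin n} {k : Fin C.K} :
    i ∈ C.cluster k ↔ C.label i = k :=
  ⟨C.label_eq, fun h => h ▸ C.mem_label i⟩

theorem sortedDesc_label_clusteringOf (B : Fin n → ℝ) (i : Fin n) :
    sortedDesc (distinctValues B) rfl ((clusteringOf B).label i) = B i := by
  have : i ∈ (clusteringOf B).cluster ((clusteringOf B).label i) :=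
    (clusteringOf B).mem_label i
  exact (mem_filter.1 this).2.symm

/-- `State.step` sorts the values of `bhat`, while `clusteringOf` sorts those of `Bhat`; the two
sets are equal but not definitionally so. -/
theorem sortedDesc_congr {K : ℕ} {s t : Finset ℝ} (hst : s = t) (hs : s.card = K)
    (ht : t.card = K) : sortedDesc s hs = sortedDesc t ht := by
  subst hst; rfl

/-! ### One step of the algorithm -/

namespace State

variable (S : State n)

theorem one_le_K (hn : 1 ≤ n) : 1 ≤ S.K :=
  (Nat.zero_le _).trans_lt (S.clusters.label ⟨0, hn⟩).isLt

theorem sum_size (s : Finset (Fin S.clusters.K)) :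
    ∑ k ∈ s, (S.size k : ℝ) = ∑ j, if S.clusters.label j ∈ s then (1 : ℝ) else 0 := by
  have : ∀ k, S.clusters.cluster k = univ.filter fun j => S.clusters.label j = k := fun k => by
    ext j; simp [S.clusters.mem_cluster_iff]
  simp only [size, this, card_filter, Nat.cast_sum, Nat.cast_ite, Nat.cast_one, Nat.cast_zero]
  rw [sum_comm]
  exact sum_congr rfl fun j _ => by simp

theorem size_pos (k : Fin S.clusters.K) : (0 : ℝ) < S.size k :=
  Nat.cast_pos.2 (S.clusters.nonempty k).card_pos

@[simp] theorem bhat_lam : S.bhat S.lam = S.b := by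
  funext k; simp [bhat]

/-- Neighbouring slopes differ by the sum of the two cluster sizes, whence the denominators in
`nextLam`. -/
theorem bhat_sub_bhat_succ (t : ℝ) {k l : Fin S.clusters.K} (hkl : (l : ℕ) = k + 1) :
    S.bhat t k - S.bhat t l = S.b k - S.b l - (t - S.lam) * (S.size k + S.size l) := by
  have h1 : Iio l = insert k (Iio k) := by
    ext m; simp only [mem_Iio, mem_insert, Fin.lt_def, Fin.ext_iff]; omega
  have h2 : Ioi k = insert l (Ioi l) := by
    ext m; simp only [mem_Ioi, mem_insert, Fin.lt_def, Fin.ext_iff]; omega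
  simp only [bhat]
  rw [h1, h2, sum_insert (by simp), sum_insert (by simp)]
  ring

theorem lam_le_nextLam (hb : StrictAnti S.b) (h : 2 ≤ S.K) : S.lam ≤ S.nextLam h := by
  refine le_add_of_nonneg_right (le_inf' _ _ fun k _ => div_nonneg ?_ (by positivity))
  exact sub_nonneg.2 (hb.antitone (Fin.le_def.2 (Nat.le_succ _)))

theorem bhat_antitone (h : 2 ≤ S.K) {t : ℝ} (ht : t ≤ S.nextLam h) : Antitone (S.bhat t) := by
  have key : ∀ k l : Fin S.clusters.K, (l : ℕ) = k + 1 → S.bhat t l ≤ S.bhat t k := by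
    intro k l hkl
    rw [← sub_nonneg, S.bhat_sub_bhat_succ t hkl, sub_nonneg]
    have hpos : (0 : ℝ) < S.size k + S.size l := add_pos (S.size_pos k) (S.size_pos l)
    rw [← le_div_iff₀ hpos]
    have hl : l = ⟨k + 1, hkl ▸ l.isLt⟩ := Fin.ext hkl
    have := inf'_le (s := (univ : Finset (Fin (S.clusters.K - 1)))) (fun k =>
      (S.b ⟨k, by omega⟩ - S.b ⟨k + 1, by omega⟩) /
        ((S.size ⟨k, by omega⟩ : ℝ) + (S.size ⟨k + 1, by omega⟩ : ℝ)))
      (mem_univ ⟨k, by omega⟩)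
    rw [nextLam] at ht
    rw [hl]
    exact (sub_le_iff_le_add'.2 ht).trans this
  intro k l hkl
  obtain ⟨d, hd⟩ := Nat.exists_eq_add_of_le (Fin.le_def.1 hkl)
  induction d generalizing l with
  | zero => exact (congrArg (S.bhat t) (Fin.ext (by omega) : l = k)).le
  | succ d ih =>
    refine (key ⟨k + d, by omega⟩ l (by simp only; omega)).trans (ih ?_ rfl)
    exact Fin.le_def.2 (Nat.le_add_right _ _)

theorem bhat_nextLam_not_injective (h : 2 ≤ S.K) :
    ¬ Function.Injective (S.bhat (S.nextLam h)) := by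
  intro hinj
  obtain ⟨k, -, hk⟩ := exists_mem_eq_inf' (s := (univ : Finset (Fin (S.clusters.K - 1))))
    ⟨⟨0, Nat.sub_pos_of_lt h⟩, mem_univ _⟩ (fun k =>
      (S.b ⟨k, by omega⟩ - S.b ⟨k + 1, by omega⟩) /
        ((S.size ⟨k, by omega⟩ : ℝ) + (S.size ⟨k + 1, by omega⟩ : ℝ)))
  have hlam : S.nextLam h - S.lam = _ := (add_sub_cancel_left S.lam _).trans hk
  have hpos := add_pos (S.size_pos ⟨k, by omega⟩) (S.size_pos ⟨k + 1, by omega⟩)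
  have heq := S.bhat_sub_bhat_succ (S.nextLam h) (k := ⟨k, by omega⟩) (l := ⟨k + 1, by omega⟩) rfl
  rw [hlam, div_mul_cancel₀ _ hpos.ne', sub_self, sub_eq_zero] at heq
  have := Fin.ext_iff.1 (hinj heq)
  simp at this

theorem step_K_lt (h : 2 ≤ S.K) : (S.step h).K < S.K := by
  show (distinctValues (S.Bhat (S.nextLam h))).card < S.clusters.K
  rw [← S.distinctValues_bhat]
  refine lt_of_le_of_ne (card_image_le.trans_eq (by simp)) fun heq => ?_
  refine S.bhat_nextLam_not_injective h ?_
  rw [← Set.injOn_univ, ← coe_univ, ← card_image_iff]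
  exact heq.trans (by simp)

/-- Continuity of the path at a merge: this lets a certificate pass to the next state. -/
theorem step_Bhat_lam (h : 2 ≤ S.K) :
    (S.step h).Bhat (S.step h).lam = S.Bhat (S.nextLam h) := by
  funext i
  have hset : distinctValues (S.bhat (S.nextLam h)) = distinctValues (S.Bhat (S.nextLam h)) := by
    ext a
    simp only [distinctValues, mem_image, mem_univ, true_and, Bhat]
    exact S.clusters.label_surjective.exists
  rw [Bhat, bhat_lam]
  exact (congrFun (sortedDesc_congr hset _ rfl) _).trans (sortedDesc_label_clusteringOf _ i)

theorem init_Bhat_lam (x : Fin n → ℝ) : (init x).Bhat (init x).lam = x := by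
  funext i
  rw [Bhat, bhat_lam]
  exact sortedDesc_label_clusteringOf _ i

/-- The invariant of the algorithm: the values of the clusters are sorted, and the current vector
has an optimality certificate. -/
structure IsValid (x : Fin n → ℝ) : Prop where
  lam_nonneg : 0 ≤ S.lam
  strictAnti : StrictAnti S.b
  exists_certificate : ∃ w, IsCertificate x S.lam (S.Bhat S.lam) w

theorem init_isValid (x : Fin n → ℝ) : (init x).IsValid x where
  lam_nonneg := le_rfl
  strictAnti := sortedDesc_strictAnti _ _
  exists_certificate := by
    rw [init_Bhat_lam]
    exact ⟨0, by simp, by simp [init], by simp [init], by simp⟩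

variable {S}

theorem IsValid.exists_certificate_of_antitone {x : Fin n → ℝ} (hS : S.IsValid x) {t : ℝ}
    (ht : S.lam ≤ t) (hanti : Antitone (S.bhat t)) :
    ∃ w, IsCertificate x t (S.Bhat t) w := by
  obtain ⟨w, hw⟩ := hS.exists_certificate
  have hmul := hw.mul_sub
  simp only [Bhat, bhat_lam] at hmul
  -- Distinct clusters have distinct values at `S.lam`, so the subgradient is unique there.
  have hlt : ∀ i j, S.clusters.label i < S.clusters.label j → w i j = S.lam := fun i j hij => by
    have hpos := sub_pos.2 (hS.strictAnti hij)
    have := hmul i j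
    rw [abs_of_pos hpos] at this
    exact mul_right_cancel₀ hpos.ne' this
  have hgt : ∀ i j, S.clusters.label j < S.clusters.label i → w i j = -S.lam := fun i j hij => by
    rw [hw.antisymm j i, hlt j i hij]
  have hnn := hS.lam_nonneg
  -- The added term is `t - S.lam` times the sign of the label difference: it is zero inside a
  -- cluster, where the old bound only relaxes.
  refine ⟨fun i j => w i j + (t - S.lam) *
    ((if S.clusters.label j ∈ Ioi (S.clusters.label i) then 1 else 0) -
      if S.clusters.label j ∈ Iio (S.clusters.label i) then 1 else 0),
    fun i j => ?_, fun i j => ?_, fun i j => ?_, fun i => ?_⟩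
  · simp only [mem_Ioi, mem_Iio, hw.antisymm i j]; ring
  · rcases lt_trichotomy (S.clusters.label i) (S.clusters.label j) with h | h | h
    · simp [h, h.not_gt, hlt i j h, abs_of_nonneg (hnn.trans ht)]
    · simpa [h] using (hw.abs_le i j).trans ht
    · simp only [mem_Ioi, mem_Iio, h, h.not_gt, if_true, if_false, hgt i j h]
      rw [abs_le]
      constructor <;> linarith
  -- Weak order at time `t` suffices: when two clusters collide, both sides vanish.
  · simp only [Bhat]
    rcases lt_trichotomy (S.clusters.label i) (S.clusters.label j) with h | h | h
    · simp [h, h.not_gt, hlt i j h, abs_of_nonneg (sub_nonneg.2 (hanti h.le))]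
    · simp [h]
    · simp only [mem_Ioi, mem_Iio, h, h.not_gt, if_true, if_false, hgt i j h,
        abs_of_nonpos (sub_nonpos.2 (hanti h.le))]
      ring
  · have := hw.stationary i
    simp only [Bhat, bhat_lam] at this
    rw [sum_add_distrib, ← this, ← mul_sum, sum_sub_distrib, ← sum_size, ← sum_size, Bhat, bhat]
    ring

theorem IsValid.step {x : Fin n → ℝ} (hS : S.IsValid x) (h : 2 ≤ S.K) : (S.step h).IsValid x where
  lam_nonneg := hS.lam_nonneg.trans (S.lam_le_nextLam hS.strictAnti h)
  strictAnti := sortedDesc_strictAnti _ _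
  exists_certificate := by
    rw [step_Bhat_lam]
    exact hS.exists_certificate_of_antitone (S.lam_le_nextLam hS.strictAnti h)
      (S.bhat_antitone h le_rfl)

end State

/-! ### Termination and the whole path -/

theorem path_succ {x : Fin n → ℝ} {r : ℕ} (h : 2 ≤ (path x r).K) :
    path x (r + 1) = (path x r).step h := dif_pos h

theorem path_isValid (x : Fin n → ℝ) (r : ℕ) : (path x r).IsValid x := by
  induction r with
  | zero => exact State.init_isValid x
  | succ r ih =>
    rw [path]
    split_ifs with h
    exacts [ih.step h, ih]

theorem path_succ_K_lt {x : Fin n → ℝ} {r : ℕ} (h : 2 ≤ (path x r).K) :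
    (path x (r + 1)).K < (path x r).K := by
  rw [path_succ h]
  exact (path x r).step_K_lt h

theorem path_K_add_le {x : Fin n → ℝ} {r : ℕ} (h : ∀ s < r, 2 ≤ (path x s).K) :
    (path x r).K + r ≤ n := by
  induction r with
  | zero => exact card_image_le.trans_eq (card_fin n)
  | succ r ih =>
    have := ih fun s hs => h s (hs.trans r.lt_succ_self)
    have := path_succ_K_lt (h r r.lt_succ_self)
    omega

theorem exists_stopsAt (x : Fin n → ℝ) : ∃ r, StopsAt x r := by
  classical
  have hex : ∃ r, ¬ 2 ≤ (path x r).K := by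
    by_contra! hcon
    have := path_K_add_le (r := n + 1) fun s _ => hcon s
    omega
  exact ⟨Nat.find hex, fun s hs => not_not.1 (Nat.find_min hex hs), Nat.find_spec hex⟩

end ConvexClustering

open ConvexClustering in
theorem mainTheorem2 (n : ℕ) (hn : 1 ≤ n) (x : Fin n → ℝ) :
    ∃ rmax : ℕ, ConvexClustering.StopsAt x rmax ∧ rmax ≤ n - 1 ∧
      (∀ r < rmax, (ConvexClustering.path x (r + 1)).K < (ConvexClustering.path x r).K) ∧
      (ConvexClustering.path x rmax).K = 1 ∧
      (∀ r ≤ rmax, ∀ lam : ℝ, (ConvexClustering.path x r).lam ≤ lam →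
        (r < rmax → lam < (ConvexClustering.path x (r + 1)).lam) →
        ConvexClustering.IsMinimizer x lam ((ConvexClustering.path x r).Bhat lam) ∧
        ∀ B : Fin n → ℝ, ConvexClustering.IsMinimizer x lam B →
          B = (ConvexClustering.path x r).Bhat lam) ∧
      (∀ lam : ℝ, (ConvexClustering.path x rmax).lam ≤ lam →
        ∀ i, (ConvexClustering.path x rmax).Bhat lam i = (∑ j, x j) / n) := by
  obtain ⟨rmax, hmax⟩ := exists_stopsAt x
  have hK1 := (path x rmax).one_le_K hn
  have hK : (path x rmax).K = 1 := by have := hmax.2; omega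
  have hle := path_K_add_le hmax.1
  have hsub : Subsingleton (Fin (path x rmax).clusters.K) :=
    Fin.subsingleton_iff_le_one.2 hK.le
  -- With a single cluster no collision can occur, so the certificate extends to all larger `t`.
  have hlast : ∀ t, Antitone ((path x rmax).bhat t) := fun t k l _ =>
    (congrArg _ (Subsingleton.elim l k)).le
  refine ⟨rmax, hmax, by omega, fun r hr => path_succ_K_lt (hmax.1 r hr), hK, ?_, ?_⟩
  · intro r hr lam hlam hlt
    have hanti : Antitone ((path x r).bhat lam) := by
      rcases hr.lt_or_eq with hr | rfl
      · have h2 := hmax.1 r hr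
        have := hlt hr
        rw [path_succ h2] at this
        exact (path x r).bhat_antitone h2 this.le
      · exact hlast lam
    obtain ⟨w, hw⟩ := (path_isValid x r).exists_certificate_of_antitone hlam hanti
    exact ⟨hw.isMinimizer, fun B => hw.eq_of_isMinimizer⟩
  · intro lam hlam i
    obtain ⟨w, hw⟩ := (path_isValid x rmax).exists_certificate_of_antitone hlam (hlast lam)
    have hconst : ∀ j, (path x rmax).Bhat lam j = (path x rmax).Bhat lam i := fun j =>
      congrArg ((path x rmax).bhat lam) (Subsingleton.elim _ _)
    -- A certificate preserves the total sum, which identifies the common value as the mean.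
    have := hw.sum_eq
    rw [sum_congr rfl fun j _ => hconst j, sum_const, card_univ, Fintype.card_fin,
      nsmul_eq_mul] at this
    rw [← this, mul_div_cancel_left₀ _ (by positivity)]
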